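/- Let $d\ge 1$. Let $\nu$ be a symmetric Lévy measure on $\mathbb R^d$, i.e. a Borel measure with $\int (1\wedge |y|^2)\,\nu(dy)<\infty$ and $\nu(-D)=\nu(D)$ for every Borel set $D$, and suppose $\nu(\mathbb R^d)=\infty$. Put $$\Phi(\xi)=\int_{\mathbb R^d}(1-\cos\langle\xi,y\rangle)\,\nu(dy),\qquad \Psi(r)=\sup_{|\xi|\le r}\Phi(\xi),\qquad \Psi^{-1}(s)=\sup\{r>0:\Psi(r)=s\},\qquad h(t)=\frac1{\Psi^{-1}(1/t)},$$ and let $(P_t)_{t\ge 0}$ be the convolution semigroup of probability measures on $\mathbb R^d$ with $\int e^{i\langle\xi,y\rangle}P_t(dy)=e^{-t\Phi(\xi)}$. For constants $M_0>0$ and $t_p\in(0,\infty]$ consider the condition $$\textbf{(A1)}\qquad \int_{\mathbb R^d}e^{-t\Phi(\xi)}|\xi|\,d\xi\le M_0\,h(t)^{-d-1}\quad\text{for all }t\in(0,t_p).$$ **Proposition.** For every $\eta>0$ there are constants $L_1=L_1(d,\eta,M_0)>0$ and $L_2=L_2(d,\eta,M_0)\in(0,\eta)$, depending only on $d,\eta,M_0$,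 such that for every $\nu$ as above and every $t_p\in(0,\infty]$ for which (A1) holds with the constants $M_0$ and $t_p$, each $P_t$ with $t>0$ has a continuous density $p_t$ with respect to Lebesgue measure, and $$p_t(x)\ \ge\ L_1\,t\,h(t)^{-d}\,\nu\bigl(B(x,L_2h(t))\bigr)\qquad\text{whenever } t\in(0,t_p),\ |x|\ge\eta\,h(t),$$ where $B(x,r)$ denotes the open ball with centre $x$ and radius $r$. -/

import Mathlib

open MeasureTheory
open scoped RealInnerProductSpace

noncomputable section

/-- A symmetric Levy measure on `ℝ^d`: `∫ (1 ∧ |y|²) ν(dy) < ∞`, and `ν(-D) = ν(D)` for every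
Borel set `D`. The value `ν({0})` plays no role in anything below and is left free. -/
structure IsSymmetricLevyMeasure {d : ℕ} (ν : Measure (EuclideanSpace ℝ (Fin d))) : Prop where
  lintegral_lt_top : ∫⁻ y, ENNReal.ofReal (min 1 (‖y‖ ^ 2)) ∂ν < ⊤
  symm : ∀ D : Set (EuclideanSpace ℝ (Fin d)), MeasurableSet D → ν ((fun y => -y) '' D) = ν D

/-- The characteristic exponent `Φ(ξ) = ∫ (1 - cos⟨ξ, y⟩) ν(dy)`. -/
def levyExponent {d : ℕ} (ν : Measure (EuclideanSpace ℝ (Fin d)))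
    (ξ : EuclideanSpace ℝ (Fin d)) : ℝ :=
  ∫ y, (1 - Real.cos ⟪ξ, y⟫) ∂ν

/-- `Ψ(r) = sup_{|ξ| ≤ r} Φ(ξ)`. -/
def levyPsi {d : ℕ} (ν : Measure (EuclideanSpace ℝ (Fin d))) (r : ℝ) : ℝ :=
  sSup (levyExponent ν '' {ξ | ‖ξ‖ ≤ r})

/-- `Ψ⁻¹(s) = sup {r > 0 : Ψ(r) = s}`. -/
def levyPsiInv {d : ℕ} (ν : Measure (EuclideanSpace ℝ (Fin d))) (s : ℝ) : ℝ :=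
  sSup {r : ℝ | 0 < r ∧ levyPsi ν r = s}

/-- `h(t) = 1 / Ψ⁻¹(1/t)`. -/
def levyScale {d : ℕ} (ν : Measure (EuclideanSpace ℝ (Fin d))) (t : ℝ) : ℝ :=
  1 / levyPsiInv ν (1 / t)

/-- The family `(P t)`, `t ≥ 0`, of probability measures with Fourier transform
`∫ exp(i⟨ξ, y⟩) P_t(dy) = exp(-t Φ(ξ))`. As Fourier transforms determine finite measures, `P` is
unique on `[0, ∞)`, and the semigroup identity `P_{s+t} = P_s * P_t` follows. -/
structure IsLevySemigroup {d : ℕ} (ν : Measure (EuclideanSpace ℝ (Fin d)))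
    (P : ℝ → Measure (EuclideanSpace ℝ (Fin d))) : Prop where
  isProbabilityMeasure : ∀ t, 0 ≤ t → IsProbabilityMeasure (P t)
  charFun_eq : ∀ t, 0 ≤ t → ∀ ξ, charFun (P t) ξ = Complex.exp (-(t * levyExponent ν ξ : ℝ))

/-- The integral condition with constants `M₀` and `tp ∈ (0, ∞]`:
`∫ exp(-t Φ(ξ)) |ξ| dξ ≤ M₀ h(t)^{-d-1}` for all `t ∈ (0, tp)`. The integral is taken with values
in `[0, ∞]`, so the bound includes convergence. -/
def LevyConditionA1 {d : ℕ} (ν : Measure (EuclideanSpace ℝ (Fin d))) (M₀ : ℝ) (tp : EReal) :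
    Prop :=
  ∀ t : ℝ, 0 < t → (t : EReal) < tp →
    ∫⁻ ξ : EuclideanSpace ℝ (Fin d), ENNReal.ofReal (Real.exp (-t * levyExponent ν ξ) * ‖ξ‖)
      ≤ ENNReal.ofReal (M₀ * levyScale ν t ^ (-(d : ℤ) - 1))

/-- `f` is a continuous density of `μ` with respect to Lebesgue measure (there is at most one). -/
structure IsContinuousDensity {d : ℕ} (μ : Measure (EuclideanSpace ℝ (Fin d)))
    (f : EuclideanSpace ℝ (Fin d) → ℝ) : Prop where
  continuous : Continuous f
  nonneg : ∀ x, 0 ≤ f x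
  eq_withDensity : μ = volume.withDensity (fun x => ENNReal.ofReal (f x))

end

/-! Cut the jumps at radius `r = η h / 2`, where `h = h(t)`, and write `ν = ν₀ + ν₁` with `ν₁` the
finite part on `{r < ‖y‖}`. On the Fourier side `exp(-tΦ)` factors, so `p_t` is the density `p⁰_t`
of the small jumps convolved with the compound Poisson law of `tν₁`. That law dominates its one-jump
term `exp(-t|ν₁|) t ν₁`, with `|ν₁|` the total mass. Hence `p_t(x)` is at least `exp(-t|ν₁|) t`
times the integral of `p⁰_t(x - y)` over `y ∈ B(x, δh)` against `ν`; this ball lies in `{r < ‖y‖}`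
when `δ ≤ η/4` and `‖x‖ ≥ ηh`.

Two bounds remain. First, `t|ν₁| ≤ Λ` with `Λ` depending on `d` and `η` only: the tail of a law is
controlled by its characteristic function near zero, and `tΦ ≤ 1` on `‖ξ‖ < 1/h`
(`mul_measureReal_restrict_le`). Second, `p⁰_t ≥ c h^{-d}` on `B(0, δh)`
(`le_re_fourier_levySymbol`): the value at `0` is of this order because `tΦ₀ ≤ tΦ ≤ 1` on the ball
of radius `1/h`, while `tΦ ≤ tΦ₀ + 2Λ` transfers (A1) to `ν₀` at the cost of a factor `exp(2Λ)` and
controls the oscillation. The pieces meet in `ofReal_mul_measure_ball_le`.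

No process for `ν₀` is constructed: `p⁰_t` is just a Fourier transform, nonnegative because
`exp(-tΦ₀)` is a limit of characteristic functions of compound Poisson laws. -/

/-! ### Fourier inversion and positivity by Gaussian smoothing -/

section Fourier

set_option linter.unusedSectionVars false

open Filter Topology Real
open scoped FourierTransform ComplexOrder

variable {V : Type*} [NormedAddCommGroup V] [InnerProductSpace ℝ V] [FiniteDimensional ℝ V]
  [MeasurableSpace V] [BorelSpace V]

/-- The Fourier transform of `v ↦ exp(-b‖v‖²)`, a Gaussian probability density. -/
noncomputable def gaussKernel (b : ℝ) (z : V) : ℝ :=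
  (π / b) ^ (Module.finrank ℝ V / 2 : ℝ) * Real.exp (-(π ^ 2 / b) * ‖z‖ ^ 2)

lemma gaussKernel_nonneg {b : ℝ} (hb : 0 < b) (z : V) : 0 ≤ gaussKernel b z := by
  unfold gaussKernel; positivity

lemma continuous_gaussKernel (b : ℝ) : Continuous (gaussKernel b : V → ℝ) := by
  unfold gaussKernel; fun_prop

lemma fourier_exp_neg_mul_norm_sq {b : ℝ} (hb : 0 < b) (z : V) :
    𝓕 (fun v : V => Complex.exp (-(b : ℂ) * (‖v‖ : ℂ) ^ 2)) z = (gaussKernel b z : ℂ) := by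
  rw [fourier_gaussian_innerProductSpace (by simpa using hb), gaussKernel]
  push_cast
  rw [Complex.ofReal_cpow (by positivity)]
  push_cast
  congr 2
  ring

lemma integrable_gaussKernel {b : ℝ} (hb : 0 < b) : Integrable (gaussKernel b : V → ℝ) := by
  refine Integrable.const_mul ?_ _
  have hc : 0 < π ^ 2 / b := by positivity
  have h := (GaussianFourier.integrable_cexp_neg_mul_sq_norm_add (V := V)
    (b := ((π ^ 2 / b : ℝ) : ℂ)) (by rwa [Complex.ofReal_re]) 0 0).norm
  refine h.congr (ae_of_all _ fun v => ?_)
  dsimp only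
  rw [Complex.norm_exp]
  congr 1
  rw [zero_mul, add_zero, ← Complex.ofReal_neg, ← Complex.ofReal_pow, ← Complex.ofReal_mul,
    Complex.ofReal_re]

lemma integral_gaussKernel {b : ℝ} (hb : 0 < b) : ∫ z : V, gaussKernel b z = 1 := by
  have hc : 0 < π ^ 2 / b := by positivity
  unfold gaussKernel
  rw [integral_const_mul, GaussianFourier.integral_rexp_neg_mul_sq_norm hc,
    ← Real.mul_rpow (by positivity) (by positivity)]
  have : π / b * (π / (π ^ 2 / b)) = 1 := by field_simp
  rw [this, Real.one_rpow]

lemma integrable_cexp_neg_mul_norm_sq {b : ℝ} (hb : 0 < b) :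
    Integrable (fun v : V => Complex.exp (-(b : ℂ) * (‖v‖ : ℂ) ^ 2)) := by
  simpa using GaussianFourier.integrable_cexp_neg_mul_sq_norm_add (V := V)
    (b := (b : ℂ)) (by simpa using hb) 0 0

lemma norm_cexp_neg_mul_norm_sq_le {b : ℝ} (hb : 0 < b) (v : V) :
    ‖Complex.exp (-(b : ℂ) * (‖v‖ : ℂ) ^ 2)‖ ≤ 1 := by
  rw [← Complex.ofReal_neg, ← Complex.ofReal_pow, ← Complex.ofReal_mul, ← Complex.ofReal_exp,
    Complex.norm_real, Real.norm_of_nonneg (Real.exp_nonneg _)]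
  exact Real.exp_le_one_iff.2 (by nlinarith [sq_nonneg ‖v‖])

/-- Convolving `𝓕 ψ` with a finite measure multiplies `ψ` by the characteristic function. -/
lemma integral_fourier_sub {ψ : V → ℂ} (hψ : Integrable ψ) (μ : Measure V) [IsFiniteMeasure μ]
    (x : V) :
    ∫ y, 𝓕 ψ (x - y) ∂μ = 𝓕 (fun ξ => ψ ξ * charFun μ ((2 * π) • ξ)) x := by
  simp only [Real.fourier_eq', charFun_apply]
  rw [integral_integral_swap]
  · congr 1 with ξ
    simp only [smul_eq_mul]
    rw [integral_mul_const, mul_comm (ψ ξ), ← mul_assoc, ← integral_const_mul]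
    congr 2 with y
    rw [← Complex.exp_add]
    congr 1
    rw [inner_sub_right, inner_smul_right, real_inner_comm ξ y]
    push_cast
    ring
  · have h1 : Integrable (fun z : V × V => ψ z.2) (μ.prod volume) := hψ.comp_snd μ
    refine h1.mono ?_ (ae_of_all _ fun z => ?_)
    · refine AEStronglyMeasurable.smul (f := fun z : V × V =>
        Complex.exp (((-2 * π * ⟪z.2, x - z.1⟫ : ℝ) : ℂ) * Complex.I))
        (Continuous.aestronglyMeasurable (by fun_prop)) h1.1
    · simp only [Function.uncurry, norm_smul]
      rw [Complex.norm_exp_ofReal_mul_I, one_mul]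

/-- Gaussian smoothing of a finite measure in terms of its characteristic function. -/
lemma fourier_gauss_mul_charFun {b : ℝ} (hb : 0 < b) (μ : Measure V) [IsFiniteMeasure μ] (x : V) :
    𝓕 (fun ξ : V => Complex.exp (-(b : ℂ) * (‖ξ‖ : ℂ) ^ 2) * charFun μ ((2 * π) • ξ)) x =
      ((∫ y, gaussKernel b (x - y) ∂μ : ℝ) : ℂ) := by
  rw [← integral_fourier_sub (integrable_cexp_neg_mul_norm_sq hb)]
  simp only [fourier_exp_neg_mul_norm_sq hb]
  exact integral_ofReal

lemma tendsto_fourier_of_dominated {F : ℕ → V → ℂ} {ψ : V → ℂ} {g : V → ℝ}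
    (hF : ∀ n, AEStronglyMeasurable (F n) volume) (hg : Integrable g)
    (hle : ∀ n ξ, ‖F n ξ‖ ≤ g ξ) (hlim : ∀ ξ, Tendsto (fun n => F n ξ) atTop (𝓝 (ψ ξ))) (x : V) :
    Tendsto (fun n => 𝓕 (F n) x) atTop (𝓝 (𝓕 ψ x)) := by
  simp only [Real.fourier_eq']
  refine tendsto_integral_of_dominated_convergence g (fun n => ?_) hg
    (fun n => ae_of_all _ fun ξ => ?_) (ae_of_all _ fun ξ => (hlim ξ).const_smul _)
  · exact AEStronglyMeasurable.smul (f := fun ξ : V =>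
        Complex.exp (((-2 * π * ⟪ξ, x⟫ : ℝ) : ℂ) * Complex.I))
        (Continuous.aestronglyMeasurable (by fun_prop)) (hF n)
  · rw [norm_smul, Complex.norm_exp_ofReal_mul_I, one_mul]
    exact hle n ξ

/-- Gaussian damping is removed by dominated convergence, so that properties of smoothed measures
pass to `𝓕 ψ`. -/
lemma tendsto_fourier_gauss_mul {ψ : V → ℂ} (hψ : Integrable ψ) (x : V) :
    Tendsto (fun k : ℕ => 𝓕 (fun ξ : V =>
      Complex.exp (-((1 / ((k : ℝ) + 1) : ℝ) : ℂ) * (‖ξ‖ : ℂ) ^ 2) * ψ ξ) x) atTop (𝓝 (𝓕 ψ x)) := by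
  refine tendsto_fourier_of_dominated (g := fun ξ => ‖ψ ξ‖) (fun k => ?_) hψ.norm
    (fun k ξ => ?_) (fun ξ => ?_) x
  · exact AEStronglyMeasurable.mul (Continuous.aestronglyMeasurable (by fun_prop)) hψ.1
  · rw [norm_mul]
    exact mul_le_of_le_one_left (norm_nonneg _) (norm_cexp_neg_mul_norm_sq_le (by positivity) ξ)
  · have h : Tendsto (fun k : ℕ => ((1 / ((k : ℝ) + 1) : ℝ) : ℂ)) atTop (𝓝 ((0 : ℝ) : ℂ)) :=
      (Complex.continuous_ofReal.tendsto 0).comp tendsto_one_div_add_atTop_nhds_zero_nat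
    have h2 := ((h.neg.mul_const ((‖ξ‖ : ℂ) ^ 2)).cexp).mul_const (ψ ξ)
    simpa using h2

/-- The Fourier transform of an integrable limit of characteristic functions is nonnegative. -/
lemma fourier_nonneg_of_tendsto_charFun {μ : ℕ → Measure V} [∀ n, IsProbabilityMeasure (μ n)]
    {ψ : V → ℂ} (hψ : Integrable ψ)
    (hlim : ∀ ξ, Tendsto (fun n => charFun (μ n) ((2 * π) • ξ)) atTop (𝓝 (ψ ξ))) (x : V) :
    0 ≤ 𝓕 ψ x := by
  refine ge_of_tendsto' (tendsto_fourier_gauss_mul hψ x) fun k => ?_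
  have hb : (0 : ℝ) < 1 / ((k : ℝ) + 1) := by positivity
  -- The damping factor is fixed while `n → ∞`: it supplies the integrable bound, since the
  -- individual characteristic functions need not be integrable.
  refine ge_of_tendsto' (tendsto_fourier_of_dominated
    (F := fun n ξ => Complex.exp (-((1 / ((k : ℝ) + 1) : ℝ) : ℂ) * (‖ξ‖ : ℂ) ^ 2) *
      charFun (μ n) ((2 * π) • ξ)) (fun n => ?_) (integrable_cexp_neg_mul_norm_sq (V := V) hb).norm
    (fun n ξ => ?_) (fun ξ => (hlim ξ).const_mul _) x) fun n => ?_
  · exact AEStronglyMeasurable.mul (Continuous.aestronglyMeasurable (by fun_prop))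
      (measurable_charFun.comp (measurable_const_smul _)).aestronglyMeasurable
  · rw [norm_mul]
    exact mul_le_of_le_one_right (norm_nonneg _) (norm_charFun_le_one _)
  · rw [fourier_gauss_mul_charFun hb]
    exact Complex.zero_le_real.2 (integral_nonneg fun y => gaussKernel_nonneg hb _)

lemma continuous_fourier_of_integrable {ψ : V → ℂ} (hψ : Integrable ψ) : Continuous (𝓕 ψ) :=
  VectorFourier.fourierIntegral_continuous Real.continuous_fourierChar
    (by exact continuous_inner) hψ

lemma lintegral_gauss_convolution {b : ℝ} (hb : 0 < b) (μ : Measure V) [IsProbabilityMeasure μ] :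
    ∫⁻ x, ENNReal.ofReal (∫ y, gaussKernel b (x - y) ∂μ) = 1 := by
  have hbd : ∀ z : V, gaussKernel b z ≤ (π / b) ^ (Module.finrank ℝ V / 2 : ℝ) := fun z => by
    refine mul_le_of_le_one_right (by positivity) (Real.exp_le_one_iff.2 ?_)
    have : 0 ≤ π ^ 2 / b * ‖z‖ ^ 2 := by positivity
    linarith
  have hint : ∀ x : V, Integrable (fun y => gaussKernel b (x - y)) μ := fun x => by
    refine Integrable.of_bound (Continuous.aestronglyMeasurable ?_)
      ((π / b) ^ (Module.finrank ℝ V / 2 : ℝ)) (ae_of_all _ fun y => ?_)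
    · exact (continuous_gaussKernel b).comp (by fun_prop)
    · rw [Real.norm_of_nonneg (gaussKernel_nonneg hb _)]
      exact hbd _
  simp_rw [fun x => ofReal_integral_eq_lintegral_ofReal (hint x)
    (ae_of_all _ fun y => gaussKernel_nonneg hb _)]
  rw [lintegral_lintegral_swap]
  · have : ∀ y : V, ∫⁻ x, ENNReal.ofReal (gaussKernel b (x - y)) = 1 := fun y => by
      rw [lintegral_sub_right_eq_self (fun x => ENNReal.ofReal (gaussKernel b x)) y,
        ← ofReal_integral_eq_lintegral_ofReal (integrable_gaussKernel hb)
          (ae_of_all _ fun y => gaussKernel_nonneg hb _), integral_gaussKernel hb, ENNReal.ofReal_one]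
    simp [this]
  · refine (Continuous.measurable ?_).ennreal_ofReal.aemeasurable
    exact (continuous_gaussKernel b).comp (by fun_prop)

/-- A probability measure with integrable characteristic function has the density given by
Fourier inversion. -/
lemma eq_withDensity_fourier_charFun (μ : Measure V) [IsProbabilityMeasure μ]
    (hμ : Integrable fun ξ : V => charFun μ ((2 * π) • ξ)) :
    μ = volume.withDensity
      (fun x => ENNReal.ofReal (𝓕 (fun ξ : V => charFun μ ((2 * π) • ξ)) x).re) := by
  set ψ : V → ℂ := fun ξ => charFun μ ((2 * π) • ξ) with hψ
  have hnn : ∀ x, 0 ≤ 𝓕 ψ x := fun x =>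
    fourier_nonneg_of_tendsto_charFun (μ := fun _ => μ) hμ (fun ξ => tendsto_const_nhds) x
  have hre : ∀ x, ((𝓕 ψ x).re : ℂ) = 𝓕 ψ x := fun x => (Complex.eq_re_of_ofReal_le (hnn x)).symm
  have hnn' : ∀ x, 0 ≤ (𝓕 ψ x).re := fun x => (Complex.nonneg_iff.1 (hnn x)).1
  have hcont : Continuous (𝓕 ψ) := continuous_fourier_of_integrable hμ
  have hrec : Continuous fun x => (𝓕 ψ x).re := Complex.continuous_re.comp hcont
  -- Fatou along the Gaussian smoothings, each of mass one. This makes `𝓕 ψ` integrable, which the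
  -- inversion formula requires.
  have hle : ∫⁻ x, ENNReal.ofReal (𝓕 ψ x).re ≤ 1 := by
    have hlim : ∀ x : V, Tendsto (fun k : ℕ =>
        ENNReal.ofReal (∫ y, gaussKernel (1 / ((k : ℝ) + 1)) (x - y) ∂μ)) atTop
        (𝓝 (ENNReal.ofReal (𝓕 ψ x).re)) := fun x => by
      have h := (Complex.continuous_re.tendsto _).comp (tendsto_fourier_gauss_mul hμ x)
      refine (ENNReal.continuous_ofReal.tendsto _).comp (h.congr fun k => ?_)
      rw [Function.comp_apply, fourier_gauss_mul_charFun (by positivity), Complex.ofReal_re]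
    calc ∫⁻ x, ENNReal.ofReal (𝓕 ψ x).re
        = ∫⁻ x, liminf (fun k : ℕ =>
            ENNReal.ofReal (∫ y, gaussKernel (1 / ((k : ℝ) + 1)) (x - y) ∂μ)) atTop := by
          simp_rw [fun x => (hlim x).liminf_eq]
      _ ≤ liminf (fun k : ℕ => ∫⁻ x,
            ENNReal.ofReal (∫ y, gaussKernel (1 / ((k : ℝ) + 1)) (x - y) ∂μ)) atTop := by
          refine lintegral_liminf_le fun k => Measurable.ennreal_ofReal ?_
          refine (StronglyMeasurable.integral_prod_right (f := fun x y : V =>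
            gaussKernel (1 / ((k : ℝ) + 1)) (x - y)) ?_).measurable
          exact ((continuous_gaussKernel _).comp (by fun_prop)).stronglyMeasurable
      _ = 1 := by
          simp_rw [fun k : ℕ => lintegral_gauss_convolution (V := V)
            (show (0 : ℝ) < 1 / ((k : ℝ) + 1) by positivity) μ]
          simp
  have hint : Integrable (𝓕 ψ) := by
    refine ⟨hcont.aestronglyMeasurable, ?_⟩
    refine lt_of_eq_of_lt (lintegral_congr fun x => ?_) (hle.trans_lt ENNReal.one_lt_top)
    rw [← ofReal_norm, ← hre x, Complex.norm_real, Real.norm_of_nonneg (hnn' x), Complex.ofReal_re]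
  have hfin : IsFiniteMeasure (volume.withDensity (fun x => ENNReal.ofReal (𝓕 ψ x).re)) :=
    isFiniteMeasure_withDensity (hle.trans_lt ENNReal.one_lt_top).ne
  have hψc : Continuous ψ := (continuous_charFun (μ := μ)).comp (by fun_prop)
  have hinv : 𝓕⁻ (𝓕 ψ) = ψ := hψc.fourierInv_fourier_eq hμ hint
  refine Measure.ext_of_charFun (funext fun t => ?_)
  have h1 : charFun μ t = ψ ((2 * π)⁻¹ • t) := by
    rw [hψ]
    simp only
    rw [smul_smul, mul_inv_cancel₀ (by positivity), one_smul]
  rw [h1, ← congrFun hinv, Real.fourierInv_eq', charFun_apply,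
    integral_withDensity_eq_integral_toReal_smul hrec.measurable.ennreal_ofReal
      (ae_of_all _ fun _ => ENNReal.ofReal_lt_top)]
  refine integral_congr_ae (ae_of_all _ fun x => ?_)
  simp only
  rw [ENNReal.toReal_ofReal (hnn' x), Complex.real_smul, hre, smul_eq_mul, mul_comm, inner_smul_right,
    ← mul_assoc, mul_inv_cancel₀ (by positivity), one_mul]

end Fourier

/-! ### Compound Poisson laws -/

section CompoundPoisson

open Filter Topology
open scoped Nat

variable {V : Type*} [NormedAddCommGroup V] [InnerProductSpace ℝ V] [FiniteDimensional ℝ V]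
  [MeasurableSpace V] [BorelSpace V]

/-- The `n`-fold convolution power of a measure. -/
noncomputable def convPow {V : Type*} [NormedAddCommGroup V] [MeasurableSpace V] (μ : Measure V) :
    ℕ → Measure V
  | 0 => Measure.dirac 0
  | n + 1 => convPow μ n ∗ μ

instance isFiniteMeasure_convPow (μ : Measure V) [IsFiniteMeasure μ] (n : ℕ) :
    IsFiniteMeasure (convPow μ n) := by
  induction n with
  | zero => unfold convPow; infer_instance
  | succ n ih => unfold convPow; infer_instance

lemma charFun_convPow (μ : Measure V) [IsFiniteMeasure μ] (n : ℕ) (ξ : V) :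
    charFun (convPow μ n) ξ = charFun μ ξ ^ n := by
  induction n with
  | zero => simp [convPow, charFun_dirac]
  | succ n ih => rw [convPow, charFun_conv, ih, pow_succ]

lemma measureReal_univ_convPow (μ : Measure V) [IsFiniteMeasure μ] (n : ℕ) :
    (convPow μ n).real Set.univ = μ.real Set.univ ^ n := by
  have h := charFun_convPow μ n 0
  rw [charFun_zero, charFun_zero] at h
  exact_mod_cast h

/-- The compound Poisson law with finite jump measure `μ`. -/
noncomputable def compoundPoisson {V : Type*} [NormedAddCommGroup V] [MeasurableSpace V]
    (μ : Measure V) : Measure V :=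
  Measure.sum fun n : ℕ => ENNReal.ofReal (Real.exp (-μ.real Set.univ) / n !) • convPow μ n

lemma hasSum_exp_neg_mul_pow (a : ℝ) (z : ℂ) :
    HasSum (fun n : ℕ => ((Real.exp (-a) / n ! : ℝ) : ℂ) * z ^ n) (Complex.exp (z - a)) := by
  have h := (NormedSpace.expSeries_div_hasSum_exp z).mul_left (Complex.exp (-a))
  rw [← Complex.exp_eq_exp_ℂ, ← Complex.exp_add, neg_add_eq_sub] at h
  refine h.congr_fun fun n => ?_
  push_cast
  ring

instance isProbabilityMeasure_compoundPoisson (μ : Measure V) [IsFiniteMeasure μ] :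
    IsProbabilityMeasure (compoundPoisson μ) := by
  constructor
  rw [compoundPoisson, Measure.sum_apply _ MeasurableSet.univ]
  have h : ∀ n : ℕ, (ENNReal.ofReal (Real.exp (-μ.real Set.univ) / n !) • convPow μ n) Set.univ =
      ENNReal.ofReal (Real.exp (-μ.real Set.univ) / n ! * μ.real Set.univ ^ n) := fun n => by
    rw [Measure.smul_apply, smul_eq_mul, ← ofReal_measureReal, measureReal_univ_convPow,
      ← ENNReal.ofReal_mul (by positivity)]
  have hs : HasSum (fun n : ℕ => Real.exp (-μ.real Set.univ) / n ! * μ.real Set.univ ^ n) 1 := by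
    have := hasSum_exp_neg_mul_pow (μ.real Set.univ) (μ.real Set.univ)
    rw [sub_self, Complex.exp_zero] at this
    exact Complex.hasSum_ofReal.1 (by simpa using this)
  simp_rw [h]
  rw [← ENNReal.ofReal_tsum_of_nonneg (fun n => by positivity) hs.summable, hs.tsum_eq,
    ENNReal.ofReal_one]

lemma charFun_compoundPoisson (μ : Measure V) [IsFiniteMeasure μ] (ξ : V) :
    charFun (compoundPoisson μ) ξ = Complex.exp (charFun μ ξ - μ.real Set.univ) := by
  have hint : Integrable (fun x : V => Complex.exp (⟪x, ξ⟫ * Complex.I)) (compoundPoisson μ) := by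
    refine Integrable.of_bound (Continuous.aestronglyMeasurable (by fun_prop)) 1
      (ae_of_all _ fun x => ?_)
    rw [Complex.norm_exp_ofReal_mul_I]
  rw [charFun_apply]
  refine (hasSum_integral_measure (X := V) hint).unique ?_
  refine (hasSum_exp_neg_mul_pow (μ.real Set.univ) (charFun μ ξ)).congr_fun fun n => ?_
  rw [integral_smul_measure, ← charFun_apply, charFun_convPow,
    ENNReal.toReal_ofReal (by positivity), Complex.real_smul]

/-- The event of exactly one jump: only the term `n = 1` of the series is kept. -/
lemma smul_le_compoundPoisson (μ : Measure V) [IsFiniteMeasure μ] :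
    ENNReal.ofReal (Real.exp (-μ.real Set.univ)) • μ ≤ compoundPoisson μ := by
  have h := Measure.le_sum
    (fun n : ℕ => ENNReal.ofReal (Real.exp (-μ.real Set.univ) / n !) • convPow μ n) 1
  simpa [compoundPoisson, convPow] using h

end CompoundPoisson

/-! ### The characteristic exponent and truncation of the Lévy measure -/

section LevyExponent

open Filter Topology

variable {d : ℕ} {ν : Measure (EuclideanSpace ℝ (Fin d))}

lemma IsSymmetricLevyMeasure.integrable_min (hν : IsSymmetricLevyMeasure ν) :
    Integrable (fun y => min 1 (‖y‖ ^ 2)) ν := by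
  refine ⟨Continuous.aestronglyMeasurable (by fun_prop), lt_of_eq_of_lt ?_ hν.lintegral_lt_top⟩
  exact lintegral_congr fun y => Real.enorm_eq_ofReal (by positivity)

lemma IsSymmetricLevyMeasure.isNegInvariant (hν : IsSymmetricLevyMeasure ν) :
    ν.IsNegInvariant := by
  constructor
  ext D hD
  rw [Measure.neg, Measure.map_apply measurable_neg hD, ← hν.symm D hD]
  congr 1
  ext y
  simp

lemma isNegInvariant_restrict [ν.IsNegInvariant] {S : Set (EuclideanSpace ℝ (Fin d))}
    (hS : MeasurableSet S) (hneg : Neg.neg ⁻¹' S = S) : (ν.restrict S).IsNegInvariant := by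
  constructor
  conv_lhs => rw [Measure.neg, ← hneg, ← Measure.restrict_map measurable_neg hS]
  congr 1
  exact Measure.neg_eq_self ν

lemma one_sub_cos_inner_le (ξ y : EuclideanSpace ℝ (Fin d)) :
    1 - Real.cos ⟪ξ, y⟫ ≤ (2 + ‖ξ‖ ^ 2) * min 1 (‖y‖ ^ 2) := by
  have h1 := Real.neg_one_le_cos ⟪ξ, y⟫
  have h2 := Real.one_sub_sq_div_two_le_cos (x := ⟪ξ, y⟫)
  have h3 : ⟪ξ, y⟫ ^ 2 ≤ ‖ξ‖ ^ 2 * ‖y‖ ^ 2 := by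
    rw [← mul_pow, ← sq_abs]
    exact pow_le_pow_left₀ (abs_nonneg _) (abs_real_inner_le_norm ξ y) 2
  rcases min_cases 1 (‖y‖ ^ 2) with h | h <;> rw [h.1] <;> nlinarith [sq_nonneg ‖ξ‖, sq_nonneg ‖y‖]

lemma one_sub_cos_nonneg (x : ℝ) : 0 ≤ 1 - Real.cos x := sub_nonneg.2 (Real.cos_le_one x)

lemma integrable_one_sub_cos (hν : Integrable (fun y => min 1 (‖y‖ ^ 2)) ν)
    (ξ : EuclideanSpace ℝ (Fin d)) : Integrable (fun y => 1 - Real.cos ⟪ξ, y⟫) ν := by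
  refine (hν.const_mul (2 + ‖ξ‖ ^ 2)).mono' (Continuous.aestronglyMeasurable (by fun_prop))
    (ae_of_all _ fun y => ?_)
  rw [Real.norm_of_nonneg (one_sub_cos_nonneg _)]
  exact one_sub_cos_inner_le ξ y

lemma levyExponent_nonneg (ν : Measure (EuclideanSpace ℝ (Fin d)))
    (ξ : EuclideanSpace ℝ (Fin d)) : 0 ≤ levyExponent ν ξ :=
  integral_nonneg fun _ => one_sub_cos_nonneg _

lemma levyExponent_le (hν : Integrable (fun y => min 1 (‖y‖ ^ 2)) ν)
    (ξ : EuclideanSpace ℝ (Fin d)) :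
    levyExponent ν ξ ≤ (2 + ‖ξ‖ ^ 2) * ∫ y, min 1 (‖y‖ ^ 2) ∂ν := by
  rw [← integral_const_mul]
  exact integral_mono (integrable_one_sub_cos hν ξ) (hν.const_mul _) (one_sub_cos_inner_le ξ)

/-- The quadratic bound on the exponent makes the set under `sSup` bounded above, so the supremum is
genuine. -/
lemma levyExponent_le_levyPsi (hν : Integrable (fun y => min 1 (‖y‖ ^ 2)) ν) {r : ℝ}
    {ξ : EuclideanSpace ℝ (Fin d)} (hξ : ‖ξ‖ ≤ r) : levyExponent ν ξ ≤ levyPsi ν r := by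
  refine le_csSup ⟨(2 + r ^ 2) * ∫ y, min 1 (‖y‖ ^ 2) ∂ν, ?_⟩ ⟨ξ, hξ, rfl⟩
  rintro _ ⟨ζ, hζ, rfl⟩
  refine (levyExponent_le hν ζ).trans (mul_le_mul_of_nonneg_right ?_ ?_)
  · have : ‖ζ‖ ^ 2 ≤ r ^ 2 := pow_le_pow_left₀ (norm_nonneg _) hζ 2
    linarith
  · exact integral_nonneg fun y => by positivity

lemma abs_sin_nat_mul_le (n : ℕ) (x : ℝ) : |Real.sin (n * x)| ≤ n * |Real.sin x| := by
  induction n with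
  | zero => simp
  | succ n ih =>
    push_cast
    rw [add_mul, one_mul, Real.sin_add, add_mul, one_mul]
    refine (abs_add_le _ _).trans (add_le_add ?_ ?_)
    · rw [abs_mul]
      exact (mul_le_of_le_one_right (abs_nonneg _) (Real.abs_cos_le_one x)).trans ih
    · rw [abs_mul]
      exact mul_le_of_le_one_left (abs_nonneg _) (Real.abs_cos_le_one _)

lemma one_sub_cos_nat_mul_le (n : ℕ) (x : ℝ) :
    1 - Real.cos (n * x) ≤ n ^ 2 * (1 - Real.cos x) := by
  have h : ∀ z : ℝ, 1 - Real.cos z = 2 * |Real.sin (z / 2)| ^ 2 := fun z => by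
    have h1 := Real.cos_sq_add_sin_sq (z / 2)
    have h2 := Real.cos_two_mul (z / 2)
    rw [mul_div_cancel₀ z two_ne_zero] at h2
    rw [sq_abs]
    linarith
  rw [h, h, mul_div_assoc]
  have := pow_le_pow_left₀ (abs_nonneg _) (abs_sin_nat_mul_le n (x / 2)) 2
  rw [mul_pow] at this
  linarith

/-- Since `1 - cos z = 2 sin²(z/2)` and `|sin(nx)| ≤ n|sin x|`. This carries a bound on the exponent
from a ball to one `n` times larger. -/
lemma levyExponent_nat_smul_le (hν : Integrable (fun y => min 1 (‖y‖ ^ 2)) ν) (n : ℕ)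
    (ξ : EuclideanSpace ℝ (Fin d)) : levyExponent ν ((n : ℝ) • ξ) ≤ n ^ 2 * levyExponent ν ξ := by
  rw [levyExponent, levyExponent, ← integral_const_mul]
  refine integral_mono (integrable_one_sub_cos hν _) ((integrable_one_sub_cos hν ξ).const_mul _)
    fun y => ?_
  simp only [real_inner_smul_left]
  exact one_sub_cos_nat_mul_le n _

lemma continuous_levyExponent (hν : Integrable (fun y => min 1 (‖y‖ ^ 2)) ν) :
    Continuous (levyExponent ν) := by
  refine continuous_iff_continuousAt.2 fun ξ₀ => ?_
  refine continuousAt_of_dominated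
    (bound := fun y => (2 + (‖ξ₀‖ + 1) ^ 2) * min 1 (‖y‖ ^ 2))
    (Eventually.of_forall fun ξ => Continuous.aestronglyMeasurable (by fun_prop)) ?_
    (hν.const_mul _) (ae_of_all _ fun y => by fun_prop)
  filter_upwards [Metric.ball_mem_nhds ξ₀ one_pos] with ξ hξ
  refine ae_of_all _ fun y => ?_
  rw [Real.norm_of_nonneg (one_sub_cos_nonneg _)]
  refine (one_sub_cos_inner_le ξ y).trans (mul_le_mul_of_nonneg_right ?_ (by positivity))
  have h1 : ‖ξ‖ ≤ ‖ξ₀‖ + 1 := by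
    have := norm_le_norm_add_norm_sub' ξ ξ₀
    rw [mem_ball_iff_norm] at hξ
    linarith
  have := pow_le_pow_left₀ (norm_nonneg _) h1 2
  linarith

lemma levyExponent_restrict_add_compl (hν : Integrable (fun y => min 1 (‖y‖ ^ 2)) ν)
    {S : Set (EuclideanSpace ℝ (Fin d))} (hS : MeasurableSet S) (ξ : EuclideanSpace ℝ (Fin d)) :
    levyExponent (ν.restrict S) ξ + levyExponent (ν.restrict Sᶜ) ξ = levyExponent ν ξ :=
  integral_add_compl hS (integrable_one_sub_cos hν ξ)

lemma measure_lt_norm_lt_top (hν : Integrable (fun y => min 1 (‖y‖ ^ 2)) ν) {r : ℝ} (hr : 0 < r) :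
    ν {y | r < ‖y‖} < ⊤ := by
  refine lt_of_le_of_lt (measure_mono fun y hy => ?_)
    (hν.measure_ge_lt_top (ε := min 1 (r ^ 2)) (by positivity))
  exact min_le_min le_rfl (pow_le_pow_left₀ hr.le (le_of_lt hy) 2)

lemma measurableSet_lt_norm (r : ℝ) :
    MeasurableSet {y : EuclideanSpace ℝ (Fin d) | r < ‖y‖} :=
  measurableSet_lt measurable_const measurable_norm

lemma charFun_of_isNegInvariant (μ : Measure (EuclideanSpace ℝ (Fin d))) [IsFiniteMeasure μ]
    [μ.IsNegInvariant] (ξ : EuclideanSpace ℝ (Fin d)) :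
    charFun μ ξ = ((μ.real Set.univ - levyExponent μ ξ : ℝ) : ℂ) := by
  have hexp : Integrable (fun y => Complex.exp (⟪y, ξ⟫ * Complex.I)) μ :=
    Integrable.of_bound (Continuous.aestronglyMeasurable (by fun_prop)) 1
      (ae_of_all _ fun x => by rw [Complex.norm_exp_ofReal_mul_I])
  have hcos : Integrable (fun y => Real.cos ⟪ξ, y⟫) μ :=
    Integrable.of_bound (Continuous.aestronglyMeasurable (by fun_prop)) 1
      (ae_of_all _ fun x => Real.abs_cos_le_one _)
  -- Conjugation reflects the measure, so symmetry makes the characteristic function real.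
  have hconj : (starRingEnd ℂ) (charFun μ ξ) = charFun μ ξ := by
    rw [← charFun_neg]
    have h := charFun_map_smul (μ := μ) (-1) ξ
    rw [show ((-1 : ℝ) • ξ) = -ξ by simp] at h
    rw [← h]
    congr 1
    convert Measure.neg_eq_self μ using 1
    rw [Measure.neg]
    congr 1
    ext1 y
    simp
  rw [← Complex.conj_eq_iff_re.1 hconj]
  congr 1
  have hre : (charFun μ ξ).re = ∫ y, Real.cos ⟪ξ, y⟫ ∂μ := by
    rw [charFun_apply]
    have := integral_re hexp
    simp only [RCLike.re_to_complex] at this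
    rw [← this]
    refine integral_congr_ae (ae_of_all _ fun y => ?_)
    simp only
    rw [Complex.exp_ofReal_mul_I_re, real_inner_comm]
  rw [hre, levyExponent, integral_sub (integrable_const _) hcos]
  simp

lemma levyExponent_le_two_mul (μ : Measure (EuclideanSpace ℝ (Fin d))) [IsFiniteMeasure μ]
    (ξ : EuclideanSpace ℝ (Fin d)) : levyExponent μ ξ ≤ 2 * μ.real Set.univ := by
  have h : levyExponent μ ξ ≤ ∫ _, (2 : ℝ) ∂μ := by
    refine integral_mono_of_nonneg (ae_of_all _ fun y => one_sub_cos_nonneg _)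
      (integrable_const _) (ae_of_all _ fun y => ?_)
    have := Real.neg_one_le_cos ⟪ξ, y⟫
    simp only
    linarith
  rw [integral_const, smul_eq_mul] at h
  linarith

lemma charFun_compoundPoisson_smul (μ : Measure (EuclideanSpace ℝ (Fin d))) [IsFiniteMeasure μ]
    [μ.IsNegInvariant] {t : ℝ} (ht : 0 ≤ t) (ξ : EuclideanSpace ℝ (Fin d)) :
    charFun (compoundPoisson (t.toNNReal • μ)) ξ =
      Complex.exp (-(t * levyExponent μ ξ : ℝ)) := by
  rw [charFun_compoundPoisson]
  congr 1
  rw [charFun_apply, integral_smul_nnreal_measure, ← charFun_apply, charFun_of_isNegInvariant,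
    measureReal_nnreal_smul_apply, NNReal.smul_def, Real.coe_toNNReal t ht, Complex.real_smul]
  push_cast
  ring

/-- A finite measure carried by `{r < ‖y‖}` has mass controlled by its exponent near zero. -/
lemma measureReal_univ_le_of_levyExponent_le (μ : Measure (EuclideanSpace ℝ (Fin d)))
    [IsFiniteMeasure μ] [μ.IsNegInvariant] (hd : 1 ≤ d) {r K : ℝ} (hr : 0 < r)
    (hμ : ∀ᵐ y ∂μ, r < ‖y‖) (hK : ∀ ξ, ‖ξ‖ ≤ 2 * d / r → levyExponent μ ξ ≤ K) :
    μ.real Set.univ ≤ 2 * d * K := by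
  -- The zero measure cannot be normalised; there `ξ = 0` gives `0 ≤ K`, which suffices.
  rcases eq_or_ne μ 0 with rfl | hμ0
  · have := (levyExponent_nonneg _ _).trans (hK 0 (by simp; positivity))
    simp
    positivity
  have hd' : (0 : ℝ) < d := by exact_mod_cast hd
  have : NeZero μ := ⟨hμ0⟩
  set l : ℝ := μ.real Set.univ with hl
  have hl0 : 0 < l := measureReal_univ_pos
  set μ' : Measure (EuclideanSpace ℝ (Fin d)) := (μ Set.univ)⁻¹ • μ with hμ'
  have hprob : IsProbabilityMeasure μ' := isProbabilityMeasureSMul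
  have hcf : ∀ ξ, 1 - charFun μ' ξ = ((levyExponent μ ξ / l : ℝ) : ℂ) := fun ξ => by
    rw [charFun_apply, hμ', integral_smul_measure, ← charFun_apply, charFun_of_isNegInvariant,
      ENNReal.toReal_inv, ← Measure.real, ← hl, ← Complex.ofReal_one, Complex.real_smul,
      ← Complex.ofReal_mul, ← Complex.ofReal_sub]
    congr 1
    field_simp
    ring
  set b := EuclideanSpace.basisFun (Fin d) ℝ with hb
  have hρ : 0 < r / d := by positivity
  -- One-dimensional tail estimate: `1 - charFun μ'` is at most `K / l` on an interval of length
  -- `4d/r`, and the prefactor is `(r/d)/2`.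
  have hcoord : ∀ j, μ'.real {y | r / d < |⟪b j, y⟫|} ≤ 2 * K / l := fun j => by
    refine (measureReal_abs_inner_gt_le_integral_charFun hρ).trans ?_
    have hbound : ∀ s ∈ Set.uIoc (-2 * (r / d)⁻¹) (2 * (r / d)⁻¹),
        ‖1 - charFun μ' (s • b j)‖ ≤ K / l := fun s hs => by
      rw [hcf, Complex.norm_real, Real.norm_of_nonneg
        (div_nonneg (levyExponent_nonneg _ _) hl0.le)]
      refine div_le_div_of_nonneg_right (hK _ ?_) hl0.le
      rw [norm_smul, b.norm_eq_one, mul_one, Real.norm_eq_abs, abs_le]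
      rw [Set.uIoc_of_le (by have : 0 < (r / d)⁻¹ := by positivity
                             linarith)] at hs
      have h2 : 2 * (r / d)⁻¹ = 2 * d / r := by rw [inv_div, mul_div_assoc]
      constructor <;> linarith [hs.1, hs.2]
    refine (mul_le_mul_of_nonneg_left
      (intervalIntegral.norm_integral_le_of_norm_le_const hbound) (by positivity)).trans_eq ?_
    rw [abs_of_nonneg (by have : 0 < (r / d)⁻¹ := by positivity
                          linarith)]
    field_simp
    ring
  -- If `r < ‖y‖`, some coordinate exceeds `r / d` in absolute value, so the `d` coordinate tails
  -- cover almost all the mass.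
  have hsum : (1 : ℝ) ≤ ∑ _j : Fin d, 2 * K / l := by
    calc (1 : ℝ) = μ'.real Set.univ := by simp
      _ ≤ μ'.real (⋃ j, {y | r / d < |⟪b j, y⟫|}) := by
        refine ENNReal.toReal_mono (measure_ne_top _ _) (measure_mono_ae ?_)
        have hae : ∀ᵐ y ∂μ', r < ‖y‖ := Measure.ae_smul_measure hμ _
        filter_upwards [hae] with y hy _
        by_contra hcon
        have hcon' : ∀ j, |⟪b j, y⟫| ≤ r / d := fun j => by
          by_contra h
          exact hcon (Set.mem_iUnion.2 ⟨j, lt_of_not_ge h⟩)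
        have : ‖y‖ ≤ r := by
          calc ‖y‖ = ‖∑ j, ⟪b j, y⟫ • b j‖ := by rw [b.sum_repr']
            _ ≤ ∑ j, ‖⟪b j, y⟫ • b j‖ := norm_sum_le _ _
            _ ≤ ∑ _j : Fin d, r / d := Finset.sum_le_sum fun j _ => by
              rw [norm_smul, b.norm_eq_one, mul_one]
              exact hcon' j
            _ = r := by
              rw [Finset.sum_const, Finset.card_univ, Fintype.card_fin, nsmul_eq_mul]
              field_simp
        exact absurd hy this.not_gt
      _ ≤ ∑ j, μ'.real {y | r / d < |⟪b j, y⟫|} := measureReal_iUnion_fintype_le _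
      _ ≤ ∑ _j : Fin d, 2 * K / l := Finset.sum_le_sum fun j _ => hcoord j
  rw [Finset.sum_const, Finset.card_univ, Fintype.card_fin, nsmul_eq_mul, ← mul_div_assoc,
    le_div_iff₀ hl0] at hsum
  linarith

lemma tendsto_levyExponent_restrict (hν : Integrable (fun y => min 1 (‖y‖ ^ 2)) ν)
    (ξ : EuclideanSpace ℝ (Fin d)) :
    Tendsto (fun n : ℕ => levyExponent (ν.restrict {y | 1 / ((n : ℝ) + 1) < ‖y‖}) ξ) atTop
      (𝓝 (levyExponent ν ξ)) := by
  have hint := integrable_one_sub_cos hν ξ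
  have h : ∀ n : ℕ, levyExponent (ν.restrict {y | 1 / ((n : ℝ) + 1) < ‖y‖}) ξ =
      ∫ y, {y | 1 / ((n : ℝ) + 1) < ‖y‖}.indicator (fun y => 1 - Real.cos ⟪ξ, y⟫) y ∂ν :=
    fun n => (integral_indicator (measurableSet_lt_norm _)).symm
  simp_rw [h]
  refine tendsto_integral_of_dominated_convergence _
    (fun n => hint.1.indicator (measurableSet_lt_norm _)) hint.norm
    (fun n => ae_of_all _ fun y => norm_indicator_le_norm_self _ _) (ae_of_all _ fun y => ?_)
  -- The origin is never in the truncated set, but `1 - cos 0 = 0`, so an atom of `ν` there is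
  -- harmless.
  rcases eq_or_ne y 0 with rfl | hy
  · simp [Set.indicator]
  · refine tendsto_const_nhds.congr' ?_
    filter_upwards [tendsto_one_div_add_atTop_nhds_zero_nat.eventually_lt_const
      (show (0 : ℝ) < ‖y‖ from norm_pos_iff.2 hy)] with n hn
    exact (Set.indicator_of_mem (f := fun y => 1 - Real.cos ⟪ξ, y⟫) (s := {y | 1 / ((n : ℝ) + 1) < ‖y‖}) hn).symm

end LevyExponent

/-! ### Lower bound near the origin for the Fourier transform of the symbol -/

section LowerBound

open Filter Topology Real
open scoped FourierTransform ComplexOrder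

variable {d : ℕ} {ν : Measure (EuclideanSpace ℝ (Fin d))}

/-- The function `ξ ↦ exp(-t Φ(2πξ))`, whose Fourier transform is the transition density. -/
noncomputable def levySymbol (ν : Measure (EuclideanSpace ℝ (Fin d))) (t : ℝ)
    (ξ : EuclideanSpace ℝ (Fin d)) : ℂ :=
  Complex.exp (-(t * levyExponent ν ((2 * π) • ξ) : ℝ))

lemma levySymbol_eq_ofReal (t : ℝ) (ξ : EuclideanSpace ℝ (Fin d)) :
    levySymbol ν t ξ = (Real.exp (-t * levyExponent ν ((2 * π) • ξ)) : ℝ) := by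
  rw [levySymbol]
  push_cast
  congr 1
  ring

lemma norm_levySymbol (t : ℝ) (ξ : EuclideanSpace ℝ (Fin d)) :
    ‖levySymbol ν t ξ‖ = Real.exp (-t * levyExponent ν ((2 * π) • ξ)) := by
  rw [levySymbol_eq_ofReal, Complex.norm_real, Real.norm_of_nonneg (Real.exp_nonneg _)]

lemma continuous_levySymbol (hν : Integrable (fun y => min 1 (‖y‖ ^ 2)) ν) (t : ℝ) :
    Continuous (levySymbol ν t) := by
  have h : Continuous fun ξ => levyExponent ν ((2 * π) • ξ) :=
    (continuous_levyExponent hν).comp (continuous_const_smul _)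
  unfold levySymbol
  fun_prop

lemma integrable_exp_mul_norm (hν : Integrable (fun y => min 1 (‖y‖ ^ 2)) ν) {t : ℝ}
    (h : ∫⁻ ξ, ENNReal.ofReal (Real.exp (-t * levyExponent ν ξ) * ‖ξ‖) < ⊤) :
    Integrable fun ξ => Real.exp (-t * levyExponent ν ξ) * ‖ξ‖ := by
  have hc := continuous_levyExponent hν
  refine ⟨Continuous.aestronglyMeasurable (by fun_prop), lt_of_eq_of_lt ?_ h⟩
  exact lintegral_congr fun ξ => Real.enorm_eq_ofReal (by positivity)

/-- On the unit ball the exponential is at most `1`; outside it the factor `‖ξ‖` is at least `1`.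
Allowing `s ≥ t` extends integrability from small times to all later ones. -/
lemma integrable_exp_of_integrable_exp_mul_norm
    (hν : Integrable (fun y => min 1 (‖y‖ ^ 2)) ν) {t s : ℝ} (ht : 0 ≤ t) (hts : t ≤ s)
    (h : Integrable fun ξ => Real.exp (-t * levyExponent ν ξ) * ‖ξ‖) :
    Integrable fun ξ => Real.exp (-s * levyExponent ν ξ) := by
  have hc := continuous_levyExponent hν
  have hball : Integrable ((Metric.closedBall (0 : EuclideanSpace ℝ (Fin d)) 1).indicator
      fun _ => (1 : ℝ)) :=
    (integrable_indicator_iff Metric.isClosed_closedBall.measurableSet).2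
      (integrableOn_const (isCompact_closedBall _ _).measure_lt_top.ne)
  refine (hball.add h).mono' (Continuous.aestronglyMeasurable (by fun_prop))
    (ae_of_all _ fun ξ => ?_)
  have hΦ := levyExponent_nonneg ν ξ
  rw [Real.norm_of_nonneg (Real.exp_nonneg _), Pi.add_apply]
  have hts' : Real.exp (-s * levyExponent ν ξ) ≤ Real.exp (-t * levyExponent ν ξ) :=
    Real.exp_le_exp.2 (by nlinarith)
  by_cases hξ : ξ ∈ Metric.closedBall (0 : EuclideanSpace ℝ (Fin d)) 1
  · rw [Set.indicator_of_mem hξ]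
    have : Real.exp (-s * levyExponent ν ξ) ≤ 1 := Real.exp_le_one_iff.2 (by nlinarith)
    have : 0 ≤ Real.exp (-t * levyExponent ν ξ) * ‖ξ‖ := by positivity
    linarith
  · rw [Set.indicator_of_notMem hξ, zero_add]
    refine hts'.trans (le_mul_of_one_le_right (Real.exp_nonneg _) ?_)
    rw [mem_closedBall_zero_iff, not_le] at hξ
    exact hξ.le

lemma integrable_levySymbol (hν : Integrable (fun y => min 1 (‖y‖ ^ 2)) ν) {t : ℝ}
    (h : Integrable fun ξ => Real.exp (-t * levyExponent ν ξ)) :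
    Integrable (levySymbol ν t) := by
  refine (h.comp_smul (R := 2 * π) (by positivity)).mono'
    (continuous_levySymbol hν t).aestronglyMeasurable (ae_of_all _ fun ξ => ?_)
  rw [norm_levySymbol]

/-- The Fourier transform of `levySymbol ν t` is nonnegative: `exp(-tΦ)` is a limit of
characteristic functions of compound Poisson laws. -/
lemma fourier_levySymbol_nonneg (hν : Integrable (fun y => min 1 (‖y‖ ^ 2)) ν)
    [ν.IsNegInvariant] {t : ℝ} (ht : 0 ≤ t) (h : Integrable (levySymbol ν t))
    (x : EuclideanSpace ℝ (Fin d)) : 0 ≤ 𝓕 (levySymbol ν t) x := by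
  set S : ℕ → Set (EuclideanSpace ℝ (Fin d)) := fun n => {y | 1 / ((n : ℝ) + 1) < ‖y‖} with hS
  have hfin : ∀ n, IsFiniteMeasure (ν.restrict (S n)) := fun n =>
    ⟨by rw [Measure.restrict_apply_univ]; exact measure_lt_norm_lt_top hν (by positivity)⟩
  have hneg : ∀ n, (ν.restrict (S n)).IsNegInvariant := fun n =>
    isNegInvariant_restrict (measurableSet_lt_norm _) (by ext y; simp [hS])
  refine fourier_nonneg_of_tendsto_charFun
    (μ := fun n => compoundPoisson (t.toNNReal • ν.restrict (S n))) h (fun ξ => ?_) x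
  simp_rw [charFun_compoundPoisson_smul _ ht]
  have hlim := tendsto_levyExponent_restrict hν ((2 * π) • ξ)
  exact ((Complex.continuous_ofReal.tendsto _).comp (hlim.const_mul t)).neg.cexp

/-- From `|exp(iu) - 1| ≤ |u|`: the first moment of `ψ`, which (A1) controls, bounds the oscillation
of `𝓕 ψ` around `0`. -/
lemma norm_fourier_sub_fourier_zero_le {ψ : EuclideanSpace ℝ (Fin d) → ℂ} (hψ : Integrable ψ)
    (hψ1 : Integrable fun ξ => ‖ψ ξ‖ * ‖ξ‖) (z : EuclideanSpace ℝ (Fin d)) :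
    ‖𝓕 ψ z - 𝓕 ψ 0‖ ≤ ‖z‖ * (2 * π * ∫ ξ, ‖ψ ξ‖ * ‖ξ‖) := by
  have hint : ∀ w : EuclideanSpace ℝ (Fin d), Integrable fun ξ =>
      Complex.exp (((-2 * π * ⟪ξ, w⟫ : ℝ) : ℂ) * Complex.I) • ψ ξ := fun w => by
    refine hψ.mono (AEStronglyMeasurable.smul (f := fun ξ : EuclideanSpace ℝ (Fin d) =>
        Complex.exp (((-2 * π * ⟪ξ, w⟫ : ℝ) : ℂ) * Complex.I))
        (Continuous.aestronglyMeasurable (by fun_prop)) hψ.1) (ae_of_all _ fun ξ => ?_)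
    rw [norm_smul, Complex.norm_exp_ofReal_mul_I, one_mul]
  rw [Real.fourier_eq', Real.fourier_eq', ← integral_sub (hint z) (hint 0), ← integral_const_mul,
    ← integral_const_mul]
  refine norm_integral_le_of_norm_le ((hψ1.const_mul _).const_mul _) (ae_of_all _ fun ξ => ?_)
  rw [← sub_smul, norm_smul, inner_zero_right, mul_zero, Complex.ofReal_zero, zero_mul,
    Complex.exp_zero, mul_comm _ Complex.I]
  have h1 := Real.norm_exp_I_mul_ofReal_sub_one_le (x := -2 * π * ⟪ξ, z⟫)
  have h2 : ‖-2 * π * ⟪ξ, z⟫‖ ≤ 2 * π * (‖ξ‖ * ‖z‖) := by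
    rw [norm_mul, Real.norm_eq_abs, Real.norm_eq_abs, neg_mul, abs_neg,
      abs_of_pos (by positivity : 0 < 2 * π)]
    exact mul_le_mul_of_nonneg_left (abs_real_inner_le_norm ξ z) (by positivity)
  calc _ ≤ 2 * π * (‖ξ‖ * ‖z‖) * ‖ψ ξ‖ :=
        mul_le_mul_of_nonneg_right (h1.trans h2) (norm_nonneg _)
    _ = _ := by ring

/-- Near the origin the transition density of the truncated process is at least of order `R ^ d`. -/
lemma le_re_fourier_levySymbol (hν : Integrable (fun y => min 1 (‖y‖ ^ 2)) ν) {t R B : ℝ}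
    (hR : 0 < R) (ht : 0 ≤ t)
    (hΦ : ∀ ξ, ‖ξ‖ < R → t * levyExponent ν ξ ≤ 1)
    (hint : Integrable fun ξ => Real.exp (-t * levyExponent ν ξ) * ‖ξ‖)
    (hle : ∫ ξ, Real.exp (-t * levyExponent ν ξ) * ‖ξ‖ ≤ B * R ^ (d + 1))
    {z : EuclideanSpace ℝ (Fin d)}
    (hz : ‖z‖ * R * B ≤
      volume.real (Metric.ball (0 : EuclideanSpace ℝ (Fin d)) 1) / (2 * Real.exp 1)) :
    ((2 * π) ^ d)⁻¹ * (volume.real (Metric.ball (0 : EuclideanSpace ℝ (Fin d)) 1) /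
      (2 * Real.exp 1)) * R ^ d ≤ (𝓕 (levySymbol ν t) z).re := by
  set ω := volume.real (Metric.ball (0 : EuclideanSpace ℝ (Fin d)) 1) with hω
  set a : ℝ := ((2 * π) ^ d)⁻¹ with ha
  have ha0 : 0 < a := by positivity
  have hexp := integrable_exp_of_integrable_exp_mul_norm hν ht le_rfl hint
  have hψ := integrable_levySymbol hν hexp
  have hscale : ∀ f : EuclideanSpace ℝ (Fin d) → ℝ, ∫ ξ, f ((2 * π) • ξ) = a * ∫ ξ, f ξ :=
    fun f => by
      rw [Measure.integral_comp_smul, finrank_euclideanSpace_fin, abs_of_pos ha0, smul_eq_mul]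
  have hψ1 : ∀ ξ, ‖levySymbol ν t ξ‖ * ‖ξ‖ = (2 * π)⁻¹ *
      (Real.exp (-t * levyExponent ν ((2 * π) • ξ)) * ‖(2 * π) • ξ‖) := fun ξ => by
    rw [norm_levySymbol, norm_smul, Real.norm_of_nonneg (by positivity : 0 ≤ 2 * π)]
    field_simp
  have hint1 : Integrable fun ξ => ‖levySymbol ν t ξ‖ * ‖ξ‖ := by
    simp_rw [hψ1]
    exact (hint.comp_smul (R := 2 * π) (by positivity)).const_mul _
  have hdiff := norm_fourier_sub_fourier_zero_le hψ hint1 z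
  have hI : 2 * π * ∫ ξ, ‖levySymbol ν t ξ‖ * ‖ξ‖ ≤ a * (B * R ^ (d + 1)) := by
    simp_rw [hψ1]
    rw [integral_const_mul,
      hscale (fun ξ => Real.exp (-t * levyExponent ν ξ) * ‖ξ‖), ← mul_assoc,
      mul_inv_cancel₀ (by positivity), one_mul]
    exact mul_le_mul_of_nonneg_left hle ha0.le
  -- Only the ball of radius `R` is kept, where the integrand is at least `exp(-1)`.
  have hzero : a * (ω / Real.exp 1 * R ^ d) ≤ (𝓕 (levySymbol ν t) 0).re := by
    have h0 : 𝓕 (levySymbol ν t) 0 =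
        ((∫ ξ, Real.exp (-t * levyExponent ν ((2 * π) • ξ)) : ℝ) : ℂ) := by
      rw [Real.fourier_eq']
      simp only [inner_zero_right, mul_zero, Complex.ofReal_zero, zero_mul, Complex.exp_zero,
        one_smul, levySymbol_eq_ofReal]
      exact integral_ofReal
    rw [h0, Complex.ofReal_re, hscale (fun ξ => Real.exp (-t * levyExponent ν ξ))]
    refine mul_le_mul_of_nonneg_left ?_ ha0.le
    calc ω / Real.exp 1 * R ^ d
        = ∫ _ in Metric.ball (0 : EuclideanSpace ℝ (Fin d)) R, Real.exp (-1) := by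
          rw [setIntegral_const, smul_eq_mul, Measure.real,
            Measure.addHaar_ball_of_pos volume 0 hR, finrank_euclideanSpace_fin, ENNReal.toReal_mul,
            ENNReal.toReal_ofReal (by positivity), ← Measure.real, ← hω, Real.exp_neg]
          ring
      _ ≤ ∫ ξ in Metric.ball (0 : EuclideanSpace ℝ (Fin d)) R,
            Real.exp (-t * levyExponent ν ξ) := by
          refine setIntegral_mono_on (integrableOn_const measure_ball_lt_top.ne)
            hexp.integrableOn measurableSet_ball fun ξ hξ => Real.exp_le_exp.2 ?_
          have := hΦ ξ (mem_ball_zero_iff.1 hξ)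
          linarith
      _ ≤ ∫ ξ, Real.exp (-t * levyExponent ν ξ) :=
          setIntegral_le_integral hexp (ae_of_all _ fun ξ => Real.exp_nonneg _)
  have hre : (𝓕 (levySymbol ν t) 0).re - (𝓕 (levySymbol ν t) z).re ≤
      ‖z‖ * (a * (B * R ^ (d + 1))) := by
    rw [← Complex.sub_re]
    refine (Complex.re_le_norm _).trans ?_
    rw [norm_sub_rev]
    exact hdiff.trans (mul_le_mul_of_nonneg_left hI (norm_nonneg _))
  -- By `hz` the oscillation costs at most half of the lower bound at the origin.
  have hfinal : ‖z‖ * (a * (B * R ^ (d + 1))) ≤ a * (ω / (2 * Real.exp 1)) * R ^ d := by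
    calc ‖z‖ * (a * (B * R ^ (d + 1))) = a * (‖z‖ * R * B) * R ^ d := by ring
      _ ≤ _ := by gcongr
  have hsplit : a * (ω / Real.exp 1 * R ^ d) = 2 * (a * (ω / (2 * Real.exp 1)) * R ^ d) := by
    field_simp
  linarith

end LowerBound

/-! ### The scale function, the jump decomposition and the density estimate -/

section TransitionDensity

open Filter Topology Real
open scoped FourierTransform ComplexOrder

variable {d : ℕ} {ν : Measure (EuclideanSpace ℝ (Fin d))}

/-- With scale `0` the right side of (A1) would be `0`, as `0 ^ k = 0` also for negative `k`,
whereas the integrand is positive off the origin. This rules out the default values of `sSup` and of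
division by zero. -/
lemma levyScale_ne_zero (hd : 1 ≤ d) (hν : Integrable (fun y => min 1 (‖y‖ ^ 2)) ν) {M t : ℝ}
    (h : ∫⁻ ξ, ENNReal.ofReal (Real.exp (-t * levyExponent ν ξ) * ‖ξ‖)
      ≤ ENNReal.ofReal (M * levyScale ν t ^ (-(d : ℤ) - 1))) : levyScale ν t ≠ 0 := by
  intro h0
  have hc := continuous_levyExponent hν
  have : Nonempty (Fin d) := ⟨⟨0, hd⟩⟩
  rw [h0, zero_zpow _ (by omega), mul_zero, ENNReal.ofReal_zero, nonpos_iff_eq_zero,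
    lintegral_eq_zero_iff (by fun_prop)] at h
  have hfalse : ∀ᵐ _ξ : EuclideanSpace ℝ (Fin d), False := by
    filter_upwards [h, Measure.ae_ne volume (0 : EuclideanSpace ℝ (Fin d))] with ξ h1 h2
    have h3 : 0 < Real.exp (-t * levyExponent ν ξ) * ‖ξ‖ :=
      mul_pos (Real.exp_pos _) (norm_pos_iff.2 h2)
    exact (ENNReal.ofReal_pos.2 h3).ne' h1
  rw [ae_iff] at hfalse
  simp at hfalse

lemma levyScale_nonneg (ν : Measure (EuclideanSpace ℝ (Fin d))) (t : ℝ) : 0 ≤ levyScale ν t :=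
  div_nonneg zero_le_one (Real.sSup_nonneg fun _ hr => hr.1.le)

lemma mul_levyExponent_le_one (hν : Integrable (fun y => min 1 (‖y‖ ^ 2)) ν) {t : ℝ} (ht : 0 < t)
    (h : levyScale ν t ≠ 0) {ξ : EuclideanSpace ℝ (Fin d)} (hξ : ‖ξ‖ < (levyScale ν t)⁻¹) :
    t * levyExponent ν ξ ≤ 1 := by
  rw [levyScale, one_div, inv_inv] at hξ
  rw [levyScale, one_div] at h
  -- An empty level set would have supremum `0` by default, hence scale `0`.
  have hne : {r : ℝ | 0 < r ∧ levyPsi ν r = 1 / t}.Nonempty := by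
    by_contra hcon
    rw [Set.not_nonempty_iff_eq_empty] at hcon
    exact h (by rw [levyPsiInv, hcon, Real.sSup_empty, inv_zero])
  obtain ⟨r, hr, hlt⟩ := exists_lt_of_lt_csSup hne hξ
  have := (levyExponent_le_levyPsi hν hlt.le).trans_eq hr.2
  rw [le_div_iff₀ ht] at this
  linarith

/-- Total mass of the large jumps up to time `t`. -/
lemma mul_measureReal_restrict_le (hd : 1 ≤ d) (hν : Integrable (fun y => min 1 (‖y‖ ^ 2)) ν)
    [ν.IsNegInvariant] {t R r : ℝ} (ht : 0 < t) (hr : 0 < r)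
    (hΦ : ∀ ξ, ‖ξ‖ < R → t * levyExponent ν ξ ≤ 1) {n : ℕ} (hn : 0 < n)
    (hnr : 2 * d / r < n * R) :
    t * (ν.restrict {y | r < ‖y‖}).real Set.univ ≤ 2 * d * n ^ 2 := by
  have hfin : IsFiniteMeasure (ν.restrict {y | r < ‖y‖}) :=
    ⟨by rw [Measure.restrict_apply_univ]; exact measure_lt_norm_lt_top hν hr⟩
  have hneg : (ν.restrict {y | r < ‖y‖}).IsNegInvariant :=
    isNegInvariant_restrict (measurableSet_lt_norm _) (by ext y; simp)
  have hn' : (0 : ℝ) < n := by exact_mod_cast hn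
  -- For `‖ξ‖ ≤ 2d/r < nR` the point `ξ/n` lies in the ball where `tΦ ≤ 1`, so `Φ(ξ) ≤ n²/t`.
  have h := measureReal_univ_le_of_levyExponent_le (ν.restrict {y | r < ‖y‖}) hd
    (K := n ^ 2 / t) hr (ae_restrict_mem (measurableSet_lt_norm _)) fun ξ hξ => by
      have h1 := levyExponent_restrict_add_compl hν (measurableSet_lt_norm r) ξ
      have h2 := levyExponent_nonneg (ν.restrict {y | r < ‖y‖}ᶜ) ξ
      have h3 := levyExponent_nat_smul_le hν n ((n : ℝ)⁻¹ • ξ)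
      rw [smul_smul, mul_inv_cancel₀ hn'.ne', one_smul] at h3
      have h4 := hΦ ((n : ℝ)⁻¹ • ξ) (by
        rw [norm_smul, norm_inv, Real.norm_of_nonneg hn'.le, inv_mul_lt_iff₀ hn']
        exact hξ.trans_lt hnr)
      rw [le_div_iff₀ ht]
      calc _ ≤ levyExponent ν ξ * t := by gcongr; linarith
        _ ≤ n ^ 2 * levyExponent ν ((n : ℝ)⁻¹ • ξ) * t := by gcongr
        _ = n ^ 2 * (t * levyExponent ν ((n : ℝ)⁻¹ • ξ)) := by ring
        _ ≤ n ^ 2 := mul_le_of_le_one_right (by positivity) h4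
  calc _ ≤ t * (2 * d * (n ^ 2 / t)) := by gcongr
    _ = 2 * d * n ^ 2 := by field_simp

/-- The transition density is the density for the small jumps, convolved with the compound
Poisson law of the large jumps. -/
lemma fourier_levySymbol_eq_integral (hν : Integrable (fun y => min 1 (‖y‖ ^ 2)) ν)
    [ν.IsNegInvariant] {t r : ℝ} (ht : 0 ≤ t) (hr : 0 < r)
    (hint : Integrable (levySymbol (ν.restrict {y | r < ‖y‖}ᶜ) t))
    (x : EuclideanSpace ℝ (Fin d)) :
    𝓕 (levySymbol ν t) x = ∫ y, 𝓕 (levySymbol (ν.restrict {y | r < ‖y‖}ᶜ) t) (x - y)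
      ∂compoundPoisson (t.toNNReal • ν.restrict {y | r < ‖y‖}) := by
  have hfin : IsFiniteMeasure (ν.restrict {y | r < ‖y‖}) :=
    ⟨by rw [Measure.restrict_apply_univ]; exact measure_lt_norm_lt_top hν hr⟩
  have hneg : (ν.restrict {y | r < ‖y‖}).IsNegInvariant :=
    isNegInvariant_restrict (measurableSet_lt_norm _) (by ext y; simp)
  rw [integral_fourier_sub hint]
  refine congrArg (fun f : EuclideanSpace ℝ (Fin d) → ℂ => 𝓕 f x) (funext fun ξ => ?_)
  rw [charFun_compoundPoisson_smul _ ht, levySymbol, levySymbol, ← Complex.exp_add,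
    ← levyExponent_restrict_add_compl hν (measurableSet_lt_norm r)]
  congr 1
  push_cast
  ring

lemma ofReal_mul_measure_ball_le (hd : 1 ≤ d) (hν : Integrable (fun y => min 1 (‖y‖ ^ 2)) ν)
    [ν.IsNegInvariant] {M η δ t h : ℝ} (hM : 0 < M) (hη : 0 < η) (ht : 0 < t) (hh : 0 < h)
    (hΦ : ∀ ξ, ‖ξ‖ < h⁻¹ → t * levyExponent ν ξ ≤ 1)
    (hint : Integrable fun ξ => Real.exp (-t * levyExponent ν ξ) * ‖ξ‖)
    (hle : ∫ ξ, Real.exp (-t * levyExponent ν ξ) * ‖ξ‖ ≤ M * h⁻¹ ^ (d + 1))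
    {n : ℕ} (hn : 0 < n) (hnη : 4 * d / η < n) (hδη : δ ≤ η / 4)
    (hδ : δ * (Real.exp (2 * (2 * d * n ^ 2)) * M) ≤
      volume.real (Metric.ball (0 : EuclideanSpace ℝ (Fin d)) 1) / (2 * Real.exp 1))
    {x : EuclideanSpace ℝ (Fin d)} (hx : η * h ≤ ‖x‖) :
    ENNReal.ofReal (Real.exp (-(2 * d * n ^ 2)) * (((2 * π) ^ d)⁻¹ *
        (volume.real (Metric.ball (0 : EuclideanSpace ℝ (Fin d)) 1) / (2 * Real.exp 1))) *
        t * h⁻¹ ^ d) * ν (Metric.ball x (δ * h)) ≤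
      ENNReal.ofReal (𝓕 (levySymbol ν t) x).re := by
  set Λ : ℝ := 2 * d * n ^ 2 with hΛ
  set c : ℝ := ((2 * π) ^ d)⁻¹ *
    (volume.real (Metric.ball (0 : EuclideanSpace ℝ (Fin d)) 1) / (2 * Real.exp 1)) with hc
  set r : ℝ := η / 2 * h with hr_def
  have hr : 0 < r := by positivity
  set ν₁ := ν.restrict {y | r < ‖y‖} with hν₁
  set ν₀ := ν.restrict {y | r < ‖y‖}ᶜ with hν₀
  have hfin : IsFiniteMeasure ν₁ :=
    ⟨by rw [hν₁, Measure.restrict_apply_univ]; exact measure_lt_norm_lt_top hν hr⟩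
  have hneg₀ : ν₀.IsNegInvariant :=
    isNegInvariant_restrict (measurableSet_lt_norm _).compl (by ext y; simp)
  have hν₀i : Integrable (fun y => min 1 (‖y‖ ^ 2)) ν₀ := hν.restrict
  have hmass : t * ν₁.real Set.univ ≤ Λ := by
    refine mul_measureReal_restrict_le hd hν ht hr hΦ hn ?_
    calc 2 * d / r = 4 * d / η * h⁻¹ := by rw [hr_def]; field_simp; norm_num
      _ < n * h⁻¹ := by gcongr
  have hadd := levyExponent_restrict_add_compl hν (measurableSet_lt_norm r)
  -- Discarding the large jumps lowers `tΦ` by at most `2t|ν₁| ≤ 2Λ`, so `ν₀` inherits the moment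
  -- bound up to `exp(2Λ)`.
  have hexp : ∀ ξ, Real.exp (-t * levyExponent ν₀ ξ) * ‖ξ‖ ≤
      Real.exp (2 * Λ) * (Real.exp (-t * levyExponent ν ξ) * ‖ξ‖) := fun ξ => by
    rw [← mul_assoc, ← Real.exp_add]
    refine mul_le_mul_of_nonneg_right (Real.exp_le_exp.2 ?_) (norm_nonneg _)
    have h1 := mul_le_mul_of_nonneg_left (levyExponent_le_two_mul ν₁ ξ) ht.le
    rw [← hadd ξ]
    linarith
  have hc₀ := continuous_levyExponent hν₀i
  have hint₀ : Integrable fun ξ => Real.exp (-t * levyExponent ν₀ ξ) * ‖ξ‖ := by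
    refine (hint.const_mul (Real.exp (2 * Λ))).mono'
      (Continuous.aestronglyMeasurable (by fun_prop)) (ae_of_all _ fun ξ => ?_)
    rw [Real.norm_of_nonneg (by positivity)]
    exact hexp ξ
  have hle₀ : ∫ ξ, Real.exp (-t * levyExponent ν₀ ξ) * ‖ξ‖ ≤
      Real.exp (2 * Λ) * M * h⁻¹ ^ (d + 1) := by
    rw [mul_assoc]
    refine (integral_mono hint₀ (hint.const_mul _) hexp).trans ?_
    rw [integral_const_mul]
    gcongr
  have hsymb : Integrable (levySymbol ν₀ t) := integrable_levySymbol hν₀i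
    (integrable_exp_of_integrable_exp_mul_norm hν₀i ht.le le_rfl hint₀)
  have hpos : ∀ z, 0 ≤ (𝓕 (levySymbol ν₀ t) z).re := fun z =>
    (Complex.nonneg_iff.1 (fourier_levySymbol_nonneg hν₀i ht.le hsymb z)).1
  have hnear : ∀ y ∈ Metric.ball x (δ * h),
      c * h⁻¹ ^ d ≤ (𝓕 (levySymbol ν₀ t) (x - y)).re := fun y hy => by
    refine le_re_fourier_levySymbol hν₀i (B := Real.exp (2 * Λ) * M) (inv_pos.2 hh)
      ht.le (fun ξ hξ => ?_) hint₀ hle₀ (le_trans ?_ hδ)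
    · have h1 := levyExponent_nonneg ν₁ ξ
      refine (mul_le_mul_of_nonneg_left ?_ ht.le).trans (hΦ ξ hξ)
      linarith [hadd ξ]
    · gcongr
      rw [mul_inv_le_iff₀ hh, ← dist_eq_norm, dist_comm]
      exact (Metric.mem_ball.1 hy).le
  have hcont := continuous_fourier_of_integrable hsymb
  set κ := compoundPoisson (t.toNNReal • ν₁) with hκ
  have hintF : Integrable (fun y => 𝓕 (levySymbol ν₀ t) (x - y)) κ :=
    Integrable.of_bound (hcont.comp (by fun_prop)).aestronglyMeasurable
      (∫ ξ, ‖levySymbol ν₀ t ξ‖) (ae_of_all _ fun y =>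
        VectorFourier.norm_fourierIntegral_le_integral_norm _ _ _ _ _)
  have hintR : Integrable (fun y => (𝓕 (levySymbol ν₀ t) (x - y)).re) κ := hintF.re
  have hreF : (𝓕 (levySymbol ν t) x).re = ∫ y, (𝓕 (levySymbol ν₀ t) (x - y)).re ∂κ := by
    rw [fourier_levySymbol_eq_integral hν ht.le hr hsymb]
    exact (integral_re hintF).symm
  rw [hreF, ofReal_integral_eq_lintegral_ofReal hintR (ae_of_all _ fun y => hpos _)]
  -- Here `‖y‖ > ηh - ηh/4 > ηh/2`, so on this ball `ν₁` agrees with `ν`.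
  have hsub : Metric.ball x (δ * h) ⊆ {y | r < ‖y‖} := fun y hy => by
    have h1 : ‖x‖ ≤ ‖y‖ + ‖x - y‖ := norm_le_norm_add_norm_sub' x y
    rw [Metric.mem_ball, dist_comm, dist_eq_norm] at hy
    have h2 : δ * h ≤ η / 4 * h := by gcongr
    have h3 : 0 < η * h := by positivity
    rw [Set.mem_ofPred_eq, hr_def]
    linarith
  have hκle : ENNReal.ofReal (Real.exp (-Λ)) • (t.toNNReal • ν₁) ≤ κ := by
    refine le_trans ?_ (smul_le_compoundPoisson (t.toNNReal • ν₁))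
    refine Measure.le_iff.2 fun s _ => ?_
    rw [Measure.smul_apply, Measure.smul_apply _ (t.toNNReal • ν₁), smul_eq_mul, smul_eq_mul]
    gcongr
    rw [measureReal_nnreal_smul_apply, Real.coe_toNNReal t ht.le]
    exact hmass
  calc _ = ENNReal.ofReal (c * h⁻¹ ^ d) *
        (ENNReal.ofReal (Real.exp (-Λ)) • (t.toNNReal • ν₁)) (Metric.ball x (δ * h)) := by
        rw [Measure.smul_apply, Measure.smul_apply, hν₁, Measure.restrict_apply measurableSet_ball,
          Set.inter_eq_left.2 hsub, smul_eq_mul, ENNReal.smul_def, smul_eq_mul,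
          show ((t.toNNReal : ENNReal)) = ENNReal.ofReal t from rfl,
          ← mul_assoc (ENNReal.ofReal (Real.exp (-Λ))), ← ENNReal.ofReal_mul (Real.exp_nonneg _),
          ← mul_assoc (ENNReal.ofReal (c * h⁻¹ ^ d)), ← ENNReal.ofReal_mul (by positivity)]
        congr 2
        ring
    _ ≤ ENNReal.ofReal (c * h⁻¹ ^ d) * κ (Metric.ball x (δ * h)) := by gcongr
    _ = ∫⁻ _ in Metric.ball x (δ * h), ENNReal.ofReal (c * h⁻¹ ^ d) ∂κ :=
        (setLIntegral_const _ _).symm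
    _ ≤ ∫⁻ y in Metric.ball x (δ * h),
          ENNReal.ofReal (𝓕 (levySymbol ν₀ t) (x - y)).re ∂κ :=
        setLIntegral_mono' measurableSet_ball fun y hy => ENNReal.ofReal_le_ofReal (hnear y hy)
    _ ≤ _ := setLIntegral_le_lintegral _ _

lemma IsLevySemigroup.isContinuousDensity {P : ℝ → Measure (EuclideanSpace ℝ (Fin d))}
    (hP : IsLevySemigroup ν P) (hν : Integrable (fun y => min 1 (‖y‖ ^ 2)) ν)
    [ν.IsNegInvariant] {t : ℝ} (ht : 0 ≤ t) (hint : Integrable (levySymbol ν t)) :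
    IsContinuousDensity (P t) fun x => (𝓕 (levySymbol ν t) x).re where
  continuous := Complex.continuous_re.comp (continuous_fourier_of_integrable hint)
  nonneg x := (Complex.nonneg_iff.1 (fourier_levySymbol_nonneg hν ht hint x)).1
  eq_withDensity := by
    have := hP.isProbabilityMeasure t ht
    have h : (fun ξ => charFun (P t) ((2 * π) • ξ)) = levySymbol ν t :=
      funext fun ξ => hP.charFun_eq t ht _
    have := eq_withDensity_fourier_charFun (P t) (by rwa [h])
    rwa [h] at this

end TransitionDensity

/-! ### The proposition -/

theorem mainTheorem11 (d : ℕ) (hd : 1 ≤ d) (M₀ : ℝ) (hM₀ : 0 < M₀) (η : ℝ) (hη : 0 < η) :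
    ∃ L₁ L₂ : ℝ, 0 < L₁ ∧ 0 < L₂ ∧ L₂ < η ∧
      ∀ (ν : Measure (EuclideanSpace ℝ (Fin d))) (P : ℝ → Measure (EuclideanSpace ℝ (Fin d)))
        (tp : EReal),
        IsSymmetricLevyMeasure ν → ν Set.univ = ⊤ → IsLevySemigroup ν P →
        0 < tp → LevyConditionA1 ν M₀ tp →
        ∃ p : ℝ → EuclideanSpace ℝ (Fin d) → ℝ,
          (∀ t : ℝ, 0 < t → IsContinuousDensity (P t) (p t)) ∧
          ∀ t : ℝ, 0 < t → (t : EReal) < tp →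
            ∀ x : EuclideanSpace ℝ (Fin d), η * levyScale ν t ≤ ‖x‖ →
              ENNReal.ofReal (L₁ * t * levyScale ν t ^ (-(d : ℤ))) *
                  ν (Metric.ball x (L₂ * levyScale ν t))
                ≤ ENNReal.ofReal (p t x) := by
  -- With `r = ηh/2` one has `2d/r = (4d/η)/h < n/h`, the condition for bounding the large-jump mass
  -- with `Λ = 2dn²`.
  obtain ⟨n, hn⟩ := exists_nat_gt (4 * d / η)
  have hn0 : 0 < n := by
    have : (0 : ℝ) < n := lt_of_le_of_lt (by positivity) hn
    exact_mod_cast this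
  have hω : 0 < volume.real (Metric.ball (0 : EuclideanSpace ℝ (Fin d)) 1) :=
    ENNReal.toReal_pos (Metric.measure_ball_pos volume 0 one_pos).ne' measure_ball_lt_top.ne
  set ω := volume.real (Metric.ball (0 : EuclideanSpace ℝ (Fin d)) 1) with hω_def
  set A : ℝ := Real.exp (2 * (2 * d * n ^ 2)) * M₀ with hA
  have hA0 : 0 < A := by positivity
  -- `L₁` is the one-jump factor `exp(-Λ)` times the constant in the bound near the origin. In `L₂`,
  -- the first entry keeps the ball among the large jumps and the second limits the oscillation of
  -- `p⁰_t`.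
  refine ⟨Real.exp (-(2 * d * n ^ 2)) * (((2 * Real.pi) ^ d)⁻¹ * (ω / (2 * Real.exp 1))),
    min (η / 4) (ω / (2 * Real.exp 1) / A), by positivity, by positivity,
    (min_le_left _ _).trans_lt (by linarith), ?_⟩
  intro ν P tp hν _ hP htp hA1
  have hνi := hν.integrable_min
  have := hν.isNegInvariant
  have hexp : ∀ t : ℝ, 0 < t → (t : EReal) < tp →
      Integrable fun ξ => Real.exp (-t * levyExponent ν ξ) * ‖ξ‖ := fun t ht htt =>
    integrable_exp_mul_norm hνi ((hA1 t ht htt).trans_lt ENNReal.ofReal_lt_top)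
  refine ⟨fun t x => (FourierTransform.fourier (levySymbol ν t) x).re, fun t ht => ?_,
    fun t ht htt x hx => ?_⟩
  · obtain ⟨s, hs0, hsp⟩ := EReal.lt_iff_exists_real_btwn.1 htp
    have hs0' : 0 < s := EReal.coe_pos.1 hs0
    have hmin : ((min t s : ℝ) : EReal) < tp :=
      lt_of_le_of_lt (EReal.coe_le_coe_iff.2 (min_le_right t s)) hsp
    exact hP.isContinuousDensity hνi ht.le (integrable_levySymbol hνi
      (integrable_exp_of_integrable_exp_mul_norm hνi (by positivity) (min_le_left t s)
        (hexp _ (by positivity) hmin)))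
  · have hne := levyScale_ne_zero hd hνi (hA1 t ht htt)
    have hpos : 0 < levyScale ν t := lt_of_le_of_ne (levyScale_nonneg ν t) hne.symm
    have hle : ∫ ξ, Real.exp (-t * levyExponent ν ξ) * ‖ξ‖ ≤
        M₀ * (levyScale ν t)⁻¹ ^ (d + 1) := by
      rw [integral_eq_lintegral_of_nonneg_ae (ae_of_all _ fun ξ => by positivity)
        (hexp t ht htt).1]
      refine ENNReal.toReal_le_of_le_ofReal (by positivity) ((hA1 t ht htt).trans_eq ?_)
      rw [show (-(d : ℤ) - 1) = -((d + 1 : ℕ) : ℤ) by push_cast; ring, zpow_neg, zpow_natCast,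
        inv_pow]
    have hz : levyScale ν t ^ (-(d : ℤ)) = (levyScale ν t)⁻¹ ^ d := by
      rw [zpow_neg, zpow_natCast, inv_pow]
    rw [hz]
    refine ofReal_mul_measure_ball_le hd hνi hM₀ hη ht hpos
      (fun ξ hξ => mul_levyExponent_le_one hνi ht hne hξ) (hexp t ht htt) hle hn0 hn
      (min_le_left _ _) ?_ hx
    rw [← le_div_iff₀ hA0]
    exact min_le_right _ _
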